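/- Let $n,m,r$ be non-negative integers with $m\ge r$. For $S\subseteq[n]$ let $a_S\in\{0,1\}^d$, $d=n+\binom n2$, be the vector with coordinates indexed by the elements $i\in[n]$ and the edges $ij$ of the complete graph $K_n$, given by $(a_S)_i=1$ iff $i\in S$ and $(a_S)_{ij}=1$ iff $i,j\in S$. Let $P(K_n)=\operatorname{conv}\{a_S : S\subseteq[n]\}\subset\mathbb R^d$. For $a^*\in\mathbb Z_{\ge 0}^n$ let $\pi^{-1}(a^*)$ denote the set of all $a\in\mathbb Z^d\cap mP(K_n)$ whose first $n$ coordinates form $a^*$. There are $m$ agents. Agent $b$ has a graphical valuation on $K_n$, i.e. a function $v^b:2^{[n]}\to\mathbb R$ of the form $v^b(S)=\sum_{i\in S}w^b_i+\sum_{i,j\in S,\,i<j}w^b_{ij}$ with $w^b\in\mathbb R^d$. At a price $p\in\mathbb R^d$ a bundle $S$ costs $\langle p,a_S\rangle$, and the demand set of agent $b$ is $D(v^b,p)=\operatorname{argmax}_{S\subseteq[n]}\{v^b(S)-\langle p,a_S\rangle\}$. A competitive equilibrium with total allocation $a\in\mathbb Z^d$ exists at the price $p$ if there are bundles $S^1,\dots,S^m$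 with $\sum_{b=1}^m a_{S^b}=a$ and $S^b\in D(v^b,p)$ for all $b$. **Theorem.** Let $a^*\in\{0,r\}^n$. Then $\pi^{-1}(a^*)\cap\{0,r\}^d\ne\emptyset$; in particular $\pi^{-1}(a^*)\neq\emptyset$. Moreover, for every $a\in\pi^{-1}(a^*)\cap\{0,r\}^d$, and, if $r=1$, for every $a\in\pi^{-1}(a^*)$, and for all graphical valuations $v^1,\dots,v^m$ on $K_n$, there is a price $p\in\mathbb R^d$ at which a competitive equilibrium with total allocation $a$ exists. -/

import Mathlib

open scoped Pointwise

/-- Coordinates of the lifted space `ℝ^d`, `d = n + |E(G)|`: the types of goods, then the edges. -/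
abbrev LiftCoord {n : ℕ} (G : SimpleGraph (Fin n)) : Type := Fin n ⊕ G.edgeSet

open Classical in
/-- The characteristic vector `a_S ∈ {0,1}^d` of a set `S` of types: the coordinate of a type is
`1` iff the type lies in `S`; the coordinate of an edge is `1` iff both endpoints lie in `S`. -/
noncomputable def charVec {n : ℕ} (G : SimpleGraph (Fin n)) (S : Finset (Fin n)) :
    LiftCoord G → ℤ
  | Sum.inl i => if i ∈ S then 1 else 0
  | Sum.inr e => if ∀ i ∈ (e : Sym2 (Fin n)), i ∈ S then 1 else 0

open Classical in
/-- The set function with vertex and edge weights `w`: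
`S ↦ ∑_{i ∈ S} w_i + ∑_{ij ∈ E(G), i, j ∈ S} w_{ij}`.
It is used for valuations (`w` a weight vector) and for anonymous prices (`w` a price vector). -/
noncomputable def graphicalValue {n : ℕ} (G : SimpleGraph (Fin n)) (w : LiftCoord G → ℝ)
    (S : Finset (Fin n)) : ℝ :=
  ∑ i ∈ S, w (Sum.inl i) +
    ∑ e : G.edgeSet, if ∀ i ∈ (e : Sym2 (Fin n)), i ∈ S then w (Sum.inr e) else 0

/-- A valuation `2^[n] → ℝ` is graphical with underlying value graph `G`. -/
def IsGraphical {n : ℕ} (G : SimpleGraph (Fin n)) (v : Finset (Fin n) → ℝ) : Prop :=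
  ∃ w : LiftCoord G → ℝ, ∀ S, v S = graphicalValue G w S

/-- The demand set of an agent with valuation `v` at the graphical price vector `p`:
all bundles maximizing `v(S) - ⟨p, a_S⟩`. -/
def demandSet {n : ℕ} (G : SimpleGraph (Fin n)) (v : Finset (Fin n) → ℝ)
    (p : LiftCoord G → ℝ) : Set (Finset (Fin n)) :=
  {S | ∀ T : Finset (Fin n), v T - graphicalValue G p T ≤ v S - graphicalValue G p S}

/-- The auction with valuations `v` has a competitive equilibrium at the total allocation `a` and
the price `p`: there are bundles, one for each agent, whose characteristic vectors sum to `a` and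
each of which is demanded by its agent at `p`. -/
def HasCompetitiveEquilibriumAt {n m : ℕ} (G : SimpleGraph (Fin n))
    (v : Fin m → Finset (Fin n) → ℝ) (a : LiftCoord G → ℤ) (p : LiftCoord G → ℝ) : Prop :=
  ∃ S : Fin m → Finset (Fin n),
    a = ∑ b, charVec G (S b) ∧ ∀ b, S b ∈ demandSet G (v b) p

/-- The polytope `P(G)` of the graph (the correlation polytope if `G` is complete). -/
def graphPolytope {n : ℕ} (G : SimpleGraph (Fin n)) : Set (LiftCoord G → ℝ) :=
  convexHull ℝ (Set.range fun (S : Finset (Fin n)) (c : LiftCoord G) => (charVec G S c : ℝ))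

/-- The lattice points `a` of the dilated polytope `m P(G)` with `π(a) = a*`, where `π` forgets
the edge coordinates. -/
def liftedBundles {n : ℕ} (G : SimpleGraph (Fin n)) (m : ℕ) (aStar : Fin n → ℕ) :
    Set (LiftCoord G → ℤ) :=
  {a | (∀ i, a (Sum.inl i) = (aStar i : ℤ)) ∧
    (fun c => (a c : ℝ)) ∈ (m : ℝ) • graphPolytope G}

/-! Write `a` as a nonnegative combination of the `a_S`. When all coordinates lie in `{0, r}`, the
nonempty sets of positive weight are pairwise disjoint and each has weight `r`
(`exists_disjoint_family`), so `a` consists of `r` copies of each member of a disjoint family `B`.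
For `r = 1` every edge coordinate is an integer between `0` and a type coordinate, so the dichotomy
is automatic.

Treat these copies, padded with empty bundles, as indivisible items for `m` unit-demand agents. The
assignment problem has competitive item prices (duality and Hall's theorem). They become a graphical
price in two steps: disjointness lets a linear function take any prescribed values on `B`, and a
large multiple of a quadratic penalty vanishing exactly on `B` and `∅` deters every other bundle.
The penalty uses all pairs of types, hence the complete graph. -/

/-! ### The assignment problem. -/

/-- Competitive prices for the assignment problem: there are a bijection from agents to items and
item prices at which every agent weakly prefers the assigned item. -/
theorem exists_equiv_forall_sub_le {A J : Type*} [Fintype A] [Fintype J]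
    (hcard : Fintype.card A = Fintype.card J) (u : A → J → ℝ) :
    ∃ (σ : A ≃ J) (q : J → ℝ), ∀ b j, u b j - q j ≤ u b (σ b) - q (σ b) := by
  classical
  rcases isEmpty_or_nonempty J with hJ | hJ
  · exact ⟨Fintype.equivOfCardEq hcard, 0, fun _ j => isEmptyElim j⟩
  let U : A → (J → ℝ) → ℝ := fun b q =>
    Finset.univ.sup' Finset.univ_nonempty (fun j => u b j - q j)
  have hU : ∀ b q j, u b j - q j ≤ U b q := fun b q j =>
    Finset.le_sup' (fun j => u b j - q j) (Finset.mem_univ j)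
  have hU' : ∀ b q x, (∀ j, u b j - q j ≤ x) → U b q ≤ x := fun b q x h =>
    Finset.sup'_le _ _ (fun j _ => h j)
  -- The dual objective: indirect utilities plus total price. Its minimizers are the competitive
  -- prices.
  let F : (J → ℝ) → ℝ := fun q => ∑ b, U b q + ∑ j, q j
  have hFc : Continuous F := by
    refine Continuous.add (continuous_finsetSum _ fun b _ => ?_)
      (continuous_finsetSum _ fun j _ => continuous_apply j)
    exact Continuous.finset_sup'_apply _ fun j _ => continuous_const.sub (continuous_apply j)
  obtain ⟨q, hq⟩ : ∃ q, ∀ q', F q ≤ F q' := by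
    obtain ⟨C, hC⟩ : ∃ C : ℝ, ∀ b j, -C ≤ u b j := by
      refine ⟨∑ b, ∑ j, |u b j|, fun b j => ?_⟩
      have h1 : |u b j| ≤ ∑ j, |u b j| :=
        Finset.single_le_sum (f := fun j => |u b j|) (fun _ _ => abs_nonneg _) (Finset.mem_univ j)
      have h2 : ∑ j, |u b j| ≤ ∑ b, ∑ j, |u b j| :=
        Finset.single_le_sum (f := fun b => ∑ j, |u b j|)
          (fun _ _ => Finset.sum_nonneg fun _ _ => abs_nonneg _) (Finset.mem_univ b)
      linarith [neg_abs_le (u b j)]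
    -- Coercivity once the least price is normalized to zero; this confines the search to a box.
    have hlow : ∀ q : J → ℝ, (∃ j, q j = 0) → -(Fintype.card A * C) + ∑ j, q j ≤ F q := by
      rintro q ⟨j, hj⟩
      have : ∑ _b : A, (-C) ≤ ∑ b, U b q := Finset.sum_le_sum fun b _ => by
        have := hU b q j
        have := hC b j
        linarith
      simp only [Finset.sum_const, Finset.card_univ, nsmul_eq_mul] at this
      change _ ≤ ∑ b, U b q + _
      linarith
    set R := F 0 + Fintype.card A * C with hR
    have hR0 : 0 ≤ R := by
      have := hlow 0 ⟨Classical.arbitrary J, rfl⟩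
      simp only [Pi.zero_apply, Finset.sum_const_zero, add_zero] at this
      linarith
    have h0 : (0 : J → ℝ) ∈ Set.Icc (0 : J → ℝ) (fun _ => R) := ⟨le_rfl, fun _ => hR0⟩
    obtain ⟨q, -, hmin⟩ := (isCompact_Icc (a := (0 : J → ℝ)) (b := fun _ => R)).exists_isMinOn
      ⟨0, h0⟩ hFc.continuousOn
    refine ⟨q, fun q' => ?_⟩
    obtain ⟨j0, hj0⟩ := Finite.exists_min q'
    -- Equal numbers of agents and items make `F` invariant under a uniform price shift.
    have hshift : F (fun j => q' j - q' j0) = F q' := by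
      have h1 : ∀ b, U b (fun j => q' j - q' j0) = U b q' + q' j0 := fun b => by
        apply le_antisymm
        · exact hU' _ _ _ fun j => by linarith [hU b q' j]
        · rw [← le_sub_iff_add_le]
          exact hU' _ _ _ fun j => by linarith [hU b (fun j => q' j - q' j0) j]
      change ∑ b, _ + _ = ∑ b, _ + _
      simp only [h1, Finset.sum_add_distrib, Finset.sum_sub_distrib, Finset.sum_const,
        Finset.card_univ, hcard]
      ring
    rw [← hshift]
    by_cases hmem : ∀ j, q' j - q' j0 ≤ R
    · exact hmin ⟨fun j => sub_nonneg.2 (hj0 j), hmem⟩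
    · push Not at hmem
      obtain ⟨j, hj⟩ := hmem
      have h1 := hlow (fun j => q' j - q' j0) ⟨j0, sub_self _⟩
      have h2 : q' j - q' j0 ≤ ∑ j, (q' j - q' j0) :=
        Finset.single_le_sum (f := fun j => q' j - q' j0) (fun j _ => sub_nonneg.2 (hj0 j))
          (Finset.mem_univ j)
      have h3 : F q ≤ F 0 := hmin h0
      linarith
  let D : A → Finset J := fun b => Finset.univ.filter fun j => u b j - q j = U b q
  -- Hall's condition: if the agents in `s` demanded only the items of a smaller set `N`, raising
  -- prices on `N` by a small `ε` would change `F` by at most `(|N| - |s|) ε < 0`.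
  obtain ⟨f, hinj, hf⟩ := (Finset.all_card_le_biUnion_card_iff_exists_injective D).1 (by
    intro s
    by_contra! hlt
    set N := s.biUnion D with hN
    obtain ⟨ε, hε, hgap⟩ : ∃ ε > 0, ∀ b ∈ s, ∀ j ∉ N, u b j - q j ≤ U b q - ε := by
      have hev : ∀ᶠ ε in nhdsWithin (0 : ℝ) (Set.Ioi 0),
          ∀ b j, b ∈ s → j ∉ N → u b j - q j ≤ U b q - ε := by
        refine Filter.eventually_all.2 fun b => Filter.eventually_all.2 fun j => ?_
        by_cases h : b ∈ s ∧ j ∉ N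
        · have hlt : u b j - q j < U b q := lt_of_le_of_ne (hU b q j) fun heq =>
            h.2 (Finset.mem_biUnion.2 ⟨b, h.1, by simp [D, heq]⟩)
          have : Set.Iio (U b q - (u b j - q j)) ∈ nhds (0 : ℝ) := Iio_mem_nhds (by linarith)
          filter_upwards [mem_nhdsWithin_of_mem_nhds this] with ε hε _ _
          have : ε < U b q - (u b j - q j) := hε
          linarith
        · exact Filter.Eventually.of_forall fun ε h1 h2 => absurd ⟨h1, h2⟩ h
      obtain ⟨ε, h1, h2⟩ := (hev.and self_mem_nhdsWithin).exists
      exact ⟨ε, h2, fun b hb j hj => h1 b j hb hj⟩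
    let q' : J → ℝ := fun j => q j + if j ∈ N then ε else 0
    have h1 : ∀ b, U b q' ≤ U b q - if b ∈ s then ε else 0 := fun b => by
      refine hU' _ _ _ fun j => ?_
      have := hU b q j
      simp only [q']
      by_cases hb : b ∈ s <;> by_cases hj : j ∈ N <;> simp only [hb, hj, if_true, if_false]
      · linarith
      · linarith [hgap b hb j hj]
      · linarith
      · linarith
    have h2 : F q' ≤ F q - s.card * ε + N.card * ε := by
      have := Finset.sum_le_sum fun b (_ : b ∈ Finset.univ) => h1 b
      change ∑ b, U b q' + ∑ j, q' j ≤ ∑ b, U b q + ∑ j, q j - _ + _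
      simp only [Finset.sum_sub_distrib, Finset.sum_ite_mem, Finset.univ_inter, Finset.sum_const,
        nsmul_eq_mul] at this
      simp only [q', Finset.sum_add_distrib, Finset.sum_ite_mem, Finset.univ_inter,
        Finset.sum_const, nsmul_eq_mul]
      linarith
    have h3 : (N.card : ℝ) < s.card := by exact_mod_cast hlt
    have h4 := hq q'
    nlinarith)
  refine ⟨Equiv.ofBijective f ((Fintype.bijective_iff_injective_and_card f).2 ⟨hinj, hcard⟩), q,
    fun b j => ?_⟩
  have h := hf b
  simp only [D, Finset.mem_filter, Finset.mem_univ, true_and] at h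
  rw [Equiv.ofBijective_apply, h]
  exact hU b q j

/-- Competitive prices for the assignment of labelled items, where prices depend only on labels
and are set for all labels, including those carried by no item. -/
theorem exists_equiv_label_prices {A J L : Type*} [Fintype A] [Fintype J]
    (hcard : Fintype.card A = Fintype.card J) (ℓ : J → L) (v : A → L → ℝ) :
    ∃ (σ : A ≃ J) (Q : L → ℝ), ∀ b T, v b T - Q T ≤ v b (ℓ (σ b)) - Q (ℓ (σ b)) := by
  obtain ⟨σ, q, h⟩ := exists_equiv_forall_sub_le hcard fun b j => v b (ℓ j)
  rcases isEmpty_or_nonempty A with hA | hA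
  · exact ⟨σ, 0, fun b => isEmptyElim b⟩
  -- The least price of `T` at which no agent prefers it to its own item; on labels in use it is at
  -- most `q`.
  let Q : L → ℝ := fun T => Finset.univ.sup' Finset.univ_nonempty
    fun b => v b T - (v b (ℓ (σ b)) - q (σ b))
  refine ⟨σ, Q, fun b T => ?_⟩
  have h1 : v b T - (v b (ℓ (σ b)) - q (σ b)) ≤ Q T :=
    Finset.le_sup' (fun b => v b T - (v b (ℓ (σ b)) - q (σ b))) (Finset.mem_univ b)
  have h2 : Q (ℓ (σ b)) ≤ q (σ b) := Finset.sup'_le _ _ fun b' _ => by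
    linarith [h b' (σ b)]
  linarith

/-! ### Graphical functions and disjoint families. -/

section Graphical

variable {n : ℕ} {G : SimpleGraph (Fin n)}

theorem IsGraphical.add {f g : Finset (Fin n) → ℝ} (hf : IsGraphical G f) (hg : IsGraphical G g) :
    IsGraphical G (fun S => f S + g S) := by
  obtain ⟨w, hw⟩ := hf
  obtain ⟨w', hw'⟩ := hg
  refine ⟨w + w', fun S => ?_⟩
  have : ∀ (p : Prop) [Decidable p] (x y : ℝ),
      (if p then x + y else 0) = (if p then x else 0) + if p then y else 0 := by
    intros; split_ifs <;> simp
  simp only [hw, hw', graphicalValue, Pi.add_apply, Finset.sum_add_distrib, this]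
  ring

theorem IsGraphical.const_mul {f : Finset (Fin n) → ℝ} (hf : IsGraphical G f) (c : ℝ) :
    IsGraphical G (fun S => c * f S) := by
  obtain ⟨w, hw⟩ := hf
  refine ⟨c • w, fun S => ?_⟩
  simp only [hw, graphicalValue, Pi.smul_apply, smul_eq_mul, mul_add, Finset.mul_sum, mul_ite,
    mul_zero]

theorem isGraphical_zero : IsGraphical G (fun _ => 0) :=
  ⟨0, fun S => by simp [graphicalValue]⟩

theorem IsGraphical.sum {ι : Type*} (s : Finset ι) {f : ι → Finset (Fin n) → ℝ}
    (hf : ∀ i ∈ s, IsGraphical G (f i)) : IsGraphical G (fun S => ∑ i ∈ s, f i S) := by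
  classical
  induction s using Finset.induction_on with
  | empty => simpa using isGraphical_zero
  | insert i s hi ih =>
    simp only [Finset.sum_insert hi]
    exact (hf i (Finset.mem_insert_self i s)).add
      (ih fun j hj => hf j (Finset.mem_insert_of_mem hj))

theorem isGraphical_mem (i : Fin n) : IsGraphical G (fun S => if i ∈ S then 1 else 0) := by
  classical
  refine ⟨fun c => if c = Sum.inl i then 1 else 0, fun S => ?_⟩
  simp [graphicalValue]

theorem isGraphical_mem_and_mem (i j : Fin n) :
    IsGraphical (⊤ : SimpleGraph (Fin n)) (fun S => if i ∈ S ∧ j ∈ S then 1 else 0) := by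
  classical
  by_cases hij : i = j
  · subst hij
    simpa using isGraphical_mem (G := ⊤) i
  let e : (⊤ : SimpleGraph (Fin n)).edgeSet := ⟨s(i, j), by simpa using hij⟩
  refine ⟨fun c => if c = Sum.inr e then 1 else 0, fun S => ?_⟩
  simp only [graphicalValue, reduceCtorEq, if_false, Finset.sum_const_zero, zero_add,
    Sum.inr.injEq]
  rw [Finset.sum_eq_single e]
  · simp [e]
  · intro e' _ h
    simp [h]
  · simp

/-- A graphical function that vanishes on the empty set and on the members of a disjoint family,
and is at least `1` on every other set. -/
theorem exists_isGraphical_penalty (B : Finset (Finset (Fin n)))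
    (hB : (B : Set (Finset (Fin n))).Pairwise Disjoint) :
    ∃ f, IsGraphical (⊤ : SimpleGraph (Fin n)) f ∧ f ∅ = 0 ∧ (∀ C ∈ B, f C = 0) ∧
      ∀ S, S ≠ ∅ → S ∉ B → 1 ≤ f S := by
  classical
  let x : Fin n → Finset (Fin n) → ℝ := fun i S => if i ∈ S then 1 else 0
  let y : Fin n → Fin n → Finset (Fin n) → ℝ := fun i j S => if i ∈ S ∧ j ∈ S then 1 else 0
  -- For `i, j` in a common block, `g i j` charges sets that split the pair; otherwise it charges
  -- sets containing both. The diagonal `i = j` catches elements outside all blocks.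
  let g : Fin n → Fin n → Finset (Fin n) → ℝ := fun i j S =>
    if ∃ C ∈ B, i ∈ C ∧ j ∈ C then x i S + (-1) * y i j S else y i j S
  have hg : ∀ i j S, g i j S = if ∃ C ∈ B, i ∈ C ∧ j ∈ C then
      (if i ∈ S ∧ j ∉ S then 1 else 0) else if i ∈ S ∧ j ∈ S then 1 else 0 := by
    intro i j S
    by_cases hi : i ∈ S <;> by_cases hj : j ∈ S <;> simp [g, x, y, hi, hj]
  have hg0 : ∀ i j S, 0 ≤ g i j S := by
    intro i j S
    rw [hg]
    split_ifs <;> norm_num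
  refine ⟨fun S => ∑ i, ∑ j, g i j S, ?_, ?_, fun C hC => ?_, fun S hS hSB => ?_⟩
  · refine IsGraphical.sum _ fun i _ => IsGraphical.sum _ fun j _ => ?_
    by_cases h : ∃ C ∈ B, i ∈ C ∧ j ∈ C
    · simp only [g, if_pos h]
      exact (isGraphical_mem i).add ((isGraphical_mem_and_mem i j).const_mul (-1))
    · simp only [g, if_neg h]
      exact isGraphical_mem_and_mem i j
  · simp [hg]
  · refine Finset.sum_eq_zero fun i _ => Finset.sum_eq_zero fun j _ => ?_
    rw [hg]
    split_ifs with h1 h2 h3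
    · obtain ⟨C', hC', hi, hj⟩ := h1
      have : C' = C := by
        by_contra hne
        exact Finset.disjoint_left.1 (hB hC' hC hne) hi h2.1
      exact absurd (this ▸ hj) h2.2
    · rfl
    · exact absurd ⟨C, hC, h3⟩ h1
    · rfl
  · suffices ∃ i j, g i j S = 1 by
      obtain ⟨i, j, hij⟩ := this
      rw [← hij]
      exact (Finset.single_le_sum (f := fun j => g i j S) (fun j _ => hg0 i j S)
        (Finset.mem_univ j)).trans (Finset.single_le_sum (f := fun i => ∑ j, g i j S)
        (fun i _ => Finset.sum_nonneg fun j _ => hg0 i j S) (Finset.mem_univ i))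
    obtain ⟨i, hi⟩ := Finset.nonempty_iff_ne_empty.2 hS
    by_cases hcov : ∃ C ∈ B, i ∈ C
    · obtain ⟨C, hC, hiC⟩ := hcov
      by_cases hCS : C ⊆ S
      · have : ¬ S ⊆ C := fun h => hSB (h.antisymm hCS ▸ hC)
        obtain ⟨j, hjS, hjC⟩ := Finset.not_subset.1 this
        refine ⟨i, j, ?_⟩
        rw [hg, if_neg, if_pos ⟨hi, hjS⟩]
        rintro ⟨C', hC', hi', hj'⟩
        have : C' = C := by
          by_contra hne
          exact Finset.disjoint_left.1 (hB hC' hC hne) hi' hiC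
        exact hjC (this ▸ hj')
      · obtain ⟨j, hjC, hjS⟩ := Finset.not_subset.1 hCS
        exact ⟨i, j, by rw [hg, if_pos ⟨C, hC, hiC, hjC⟩, if_pos ⟨hi, hjS⟩]⟩
    · refine ⟨i, i, ?_⟩
      rw [hg, if_neg, if_pos ⟨hi, hi⟩]
      rintro ⟨C, hC, h, -⟩
      exact hcov ⟨C, hC, h⟩

/-- Prescribed values on a disjoint family of nonempty sets are attained by a graphical function
vanishing on the empty set. -/
theorem exists_isGraphical_eq_on (B : Finset (Finset (Fin n)))
    (hB : (B : Set (Finset (Fin n))).Pairwise Disjoint) (hne : ∅ ∉ B) (Q : Finset (Fin n) → ℝ) :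
    ∃ f, IsGraphical G f ∧ f ∅ = 0 ∧ ∀ C ∈ B, f C = Q C := by
  classical
  have hrep : ∀ C : B, ∃ i, i ∈ C.1 := fun C =>
    Finset.nonempty_iff_ne_empty.2 fun h => hne (h ▸ C.2)
  choose i hi using hrep
  -- All of the price of `C` sits on one representative, which by disjointness lies in no other
  -- block.
  refine ⟨fun S => ∑ C : B, Q C * if i C ∈ S then 1 else 0,
    IsGraphical.sum _ fun C _ => (isGraphical_mem (i C)).const_mul (Q C), by simp, fun C hC => ?_⟩
  beta_reduce
  rw [Finset.sum_eq_single ⟨C, hC⟩]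
  · simp [hi ⟨C, hC⟩]
  · intro C' _ hne'
    have : i C' ∉ C := fun h => Finset.disjoint_left.1
      (hB C'.2 hC fun h => hne' (Subtype.ext h)) (hi C') h
    simp [this]
  · simp

/-! ### Equilibria for disjoint bundles. -/

theorem charVec_empty : charVec G ∅ = 0 := by
  funext c
  rcases c with i | ⟨e, he⟩
  · simp [charVec]
  · induction e using Sym2.ind with
    | _ i j =>
      simp only [charVec, Finset.notMem_empty, Pi.zero_apply]
      exact if_neg fun h => h i (Sym2.mem_mk_left i j)

/-- Equilibrium prices exist for `r` copies of each member of a disjoint family of bundles. -/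
theorem exists_equilibrium_of_disjoint {m r : ℕ} (B : Finset (Finset (Fin n)))
    (hB : (B : Set (Finset (Fin n))).Pairwise Disjoint) (hne : ∅ ∉ B) (hm : B.card * r ≤ m)
    (v : Fin m → Finset (Fin n) → ℝ) :
    ∃ p, HasCompetitiveEquilibriumAt (⊤ : SimpleGraph (Fin n)) v
      (fun c => r * ∑ C ∈ B, charVec ⊤ C c) p := by
  classical
  -- Empty bundles pad the items to exactly `m`.
  let ℓ : (B × Fin r) ⊕ Fin (m - B.card * r) → Finset (Fin n) :=
    Sum.elim (fun x => x.1.1) fun _ => ∅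
  have hℓ : ∀ j, ℓ j = ∅ ∨ ℓ j ∈ B := by
    rintro (⟨C, k⟩ | k)
    · exact Or.inr C.2
    · exact Or.inl rfl
  obtain ⟨σ, Q, hQ⟩ := exists_equiv_label_prices (A := Fin m) (by simp; omega) ℓ v
  -- Subtracting `Q ∅` matches the vanishing of graphical functions at `∅` and leaves price
  -- comparisons unchanged.
  obtain ⟨f, hf, hf0, hfB⟩ := exists_isGraphical_eq_on (G := ⊤) B hB hne fun C => Q C - Q ∅
  obtain ⟨g, hg, hg0, hgB, hg1⟩ := exists_isGraphical_penalty B hB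
  have hfQ : ∀ S, S = ∅ ∨ S ∈ B → f S = Q S - Q ∅ ∧ g S = 0 := by
    rintro S (rfl | hS)
    · exact ⟨by rw [hf0, sub_self], hg0⟩
    · exact ⟨hfB S hS, hgB S hS⟩
  let z : Fin m → Finset (Fin n) → ℝ := fun b T =>
    |(v b T - f T) - (v b (ℓ (σ b)) - f (ℓ (σ b)))|
  -- Bounds any gain from deviating at price `f`, so the price `f + M * g` rules out bundles with `g
  -- ≥ 1`.
  let M : ℝ := ∑ b, ∑ T, z b T
  have hz : ∀ b T, z b T ≤ M := fun b T =>
    (Finset.single_le_sum (f := fun T => z b T) (fun _ _ => abs_nonneg _)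
      (Finset.mem_univ T)).trans (Finset.single_le_sum (f := fun b => ∑ T, z b T)
      (fun _ _ => Finset.sum_nonneg fun _ _ => abs_nonneg _) (Finset.mem_univ b))
  have hM : 0 ≤ M := Finset.sum_nonneg fun _ _ => Finset.sum_nonneg fun _ _ => abs_nonneg _
  obtain ⟨p, hp⟩ := hf.add (hg.const_mul M)
  refine ⟨p, fun b => ℓ (σ b), ?_, fun b T => ?_⟩
  · funext c
    rw [Finset.sum_apply, Equiv.sum_comp σ (fun j => charVec ⊤ (ℓ j) c), Fintype.sum_sum_type,
      Fintype.sum_prod_type]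
    simp only [ℓ, Sum.elim_inl, Sum.elim_inr, charVec_empty, Pi.zero_apply, Finset.sum_const_zero,
      add_zero, Finset.sum_const, Finset.card_univ, Fintype.card_fin, nsmul_eq_mul]
    rw [← Finset.mul_sum, Finset.sum_coe_sort B fun C => charVec ⊤ C c]
  · rw [← hp, ← hp]
    beta_reduce
    obtain ⟨h1, h2⟩ := hfQ _ (hℓ (σ b))
    rw [h2]
    by_cases hT : T = ∅ ∨ T ∈ B
    · obtain ⟨h3, h4⟩ := hfQ T hT
      rw [h1, h3, h4]
      linarith [hQ b T]
    · push Not at hT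
      have h3 := hg1 T hT.1.ne_empty hT.2
      have h4 := (le_abs_self _).trans (hz b T)
      nlinarith

/-! ### Lattice points of the dilated polytope. -/

theorem charVec_nonneg (S : Finset (Fin n)) (c : LiftCoord G) : 0 ≤ charVec G S c := by
  rcases c with i | e <;> simp only [charVec] <;> split_ifs <;> norm_num

theorem charVec_inr_le (S : Finset (Fin n)) (e : G.edgeSet) {i : Fin n}
    (hi : i ∈ (e : Sym2 (Fin n))) : charVec G S (Sum.inr e) ≤ charVec G S (Sum.inl i) := by
  simp only [charVec]
  split_ifs with h1 h2 h2
  · exact le_rfl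
  · exact absurd (h1 i hi) h2
  · norm_num
  · norm_num

/-- Points of a dilate of the graph polytope are nonnegative combinations of the characteristic
vectors whose weights sum to the dilation factor. -/
theorem exists_weights_of_mem_smul_graphPolytope {m : ℕ} {x : LiftCoord G → ℝ}
    (hx : x ∈ (m : ℝ) • graphPolytope G) :
    ∃ w : Finset (Fin n) → ℝ, (∀ S, 0 ≤ w S) ∧ ∑ S, w S = m ∧
      ∀ c, x c = ∑ S, w S * charVec G S c := by
  obtain ⟨y, hy, rfl⟩ := hx
  obtain ⟨ι, _, μ, z, hμ, hsum, hz, rfl⟩ := mem_convexHull_iff_exists_fintype.1 hy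
  choose T hT using hz
  have hfib : ∀ g : Finset (Fin n) → ℝ,
      ∑ S, (∑ i with T i = S, (m : ℝ) * μ i) * g S = ∑ i, m * μ i * g (T i) := fun g => by
    rw [← Finset.sum_fiberwise Finset.univ T fun i => m * μ i * g (T i)]
    refine Finset.sum_congr rfl fun S _ => ?_
    rw [Finset.sum_mul]
    refine Finset.sum_congr rfl fun i hi => ?_
    rw [(Finset.mem_filter.1 hi).2]
  refine ⟨fun S => ∑ i with T i = S, (m : ℝ) * μ i,
    fun S => Finset.sum_nonneg fun i _ => mul_nonneg m.cast_nonneg (hμ i), ?_, fun c => ?_⟩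
  · simpa [← Finset.mul_sum, hsum] using hfib fun _ => 1
  · rw [hfib fun S => (charVec G S c : ℝ)]
    simp only [Pi.smul_apply, Finset.sum_apply, smul_eq_mul, Finset.mul_sum, ← hT, mul_assoc]

theorem eq_zero_or_eq_one_of_mem_liftedBundles {m : ℕ} {aStar : Fin n → ℕ}
    (haStar : ∀ i, aStar i = 0 ∨ aStar i = 1)
    {a : LiftCoord G → ℤ} (ha : a ∈ liftedBundles G m aStar) (c : LiftCoord G) :
    a c = 0 ∨ a c = 1 := by
  obtain ⟨h1, h2⟩ := ha
  rcases c with i | e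
  · rw [h1]
    exact_mod_cast haStar i
  · obtain ⟨w, hw, -, hx⟩ := exists_weights_of_mem_smul_graphPolytope h2
    obtain ⟨i, hi⟩ : ∃ i, i ∈ (e : Sym2 (Fin n)) := ⟨_, Sym2.out_fst_mem _⟩
    have h3 : (0 : ℝ) ≤ a (Sum.inr e) := by
      rw [hx]
      exact Finset.sum_nonneg fun S _ => mul_nonneg (hw S) (by exact_mod_cast charVec_nonneg S _)
    have h4 : (a (Sum.inr e) : ℝ) ≤ a (Sum.inl i) := by
      rw [hx, hx]
      exact Finset.sum_le_sum fun S _ => mul_le_mul_of_nonneg_left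
        (by exact_mod_cast charVec_inr_le S e hi) (hw S)
    have h5 : 0 ≤ a (Sum.inr e) := by exact_mod_cast h3
    have h6 : a (Sum.inr e) ≤ a (Sum.inl i) := by exact_mod_cast h4
    have h7 := h1 i
    rcases haStar i with h | h <;> rw [h] at h7 <;> push_cast at h7 <;> omega

/-- A point of `m P(K_n)` with coordinates in `{0, r}` is `r` times the sum of the characteristic
vectors of a disjoint family of nonempty sets. -/
theorem exists_disjoint_family {m r : ℕ} {a : LiftCoord (⊤ : SimpleGraph (Fin n)) → ℤ}
    (ha : (fun c => (a c : ℝ)) ∈ (m : ℝ) • graphPolytope (⊤ : SimpleGraph (Fin n)))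
    (har : ∀ c, a c = 0 ∨ a c = (r : ℤ)) :
    ∃ B : Finset (Finset (Fin n)), (B : Set (Finset (Fin n))).Pairwise Disjoint ∧ ∅ ∉ B ∧
      B.card * r ≤ m ∧ a = fun c => r * ∑ C ∈ B, charVec ⊤ C c := by
  classical
  obtain ⟨w, hw, hsum, hx⟩ := exists_weights_of_mem_smul_graphPolytope ha
  let B : Finset (Finset (Fin n)) := Finset.univ.filter fun S => 0 < w S ∧ S ≠ ∅
  have hmemB : ∀ S, S ∈ B ↔ 0 < w S ∧ S ≠ ∅ := fun S => by simp [B]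
  have hpos : ∀ S c, 0 < w S → charVec ⊤ S c = 1 → a c = r := by
    intro S c hS hc
    refine (har c).resolve_left fun h0 => ?_
    have h1 := hx c
    have h2 := Finset.single_le_sum (f := fun S => w S * (charVec ⊤ S c : ℝ))
      (fun S _ => mul_nonneg (hw S) (by exact_mod_cast charVec_nonneg S c)) (Finset.mem_univ S)
    simp only [hc, h0, Int.cast_one, Int.cast_zero, mul_one] at h1 h2
    linarith
  -- For `i, j ∈ S` the coordinates of `ij` and `i` both equal `r`. Since the former is termwise at
  -- most the latter, no set of positive weight contains `i` without `j`.
  have hsub : ∀ S ∈ B, ∀ T ∈ B, ∀ i ∈ S, i ∈ T → S ⊆ T := by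
    intro S hS T hT i hiS hiT j hjS
    by_contra hjT
    have hij : i ≠ j := fun h => hjT (h ▸ hiT)
    let e : (⊤ : SimpleGraph (Fin n)).edgeSet := ⟨s(i, j), by simpa using hij⟩
    have h1 : a (Sum.inr e) = r := hpos S _ ((hmemB S).1 hS).1 (by simp [charVec, e, hiS, hjS])
    have h2 : a (Sum.inl i) = r := hpos S _ ((hmemB S).1 hS).1 (by simp [charVec, hiS])
    have h3 : ∑ U, w U * (charVec ⊤ U (Sum.inr e) : ℝ) < ∑ U, w U * (charVec ⊤ U (Sum.inl i) : ℝ) :=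
      Finset.sum_lt_sum (fun U _ => mul_le_mul_of_nonneg_left
          (by exact_mod_cast charVec_inr_le U e (by simp [e])) (hw U))
        ⟨T, Finset.mem_univ T, by simpa [charVec, e, hiT, hjT] using ((hmemB T).1 hT).1⟩
    rw [← hx, ← hx, h1, h2] at h3
    exact lt_irrefl _ h3
  have hdisj : ∀ S ∈ B, ∀ T ∈ B, ∀ i ∈ S, i ∈ T → S = T := fun S hS T hT i hiS hiT =>
    (hsub S hS T hT i hiS hiT).antisymm (hsub T hT S hS i hiT hiS)
  -- For `i ∈ S`, only `S` contributes to coordinate `i`, whose value is `r`.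
  have hwr : ∀ S ∈ B, w S = r := by
    intro S hS
    obtain ⟨i, hi⟩ := Finset.nonempty_iff_ne_empty.2 ((hmemB S).1 hS).2
    have h1 : a (Sum.inl i) = r := hpos S _ ((hmemB S).1 hS).1 (by simp [charVec, hi])
    have h2 := hx (Sum.inl i)
    rw [Finset.sum_eq_single S, h1] at h2
    · simpa [charVec, hi] using h2.symm
    · intro T _ hTS
      by_cases hiT : i ∈ T
      · have hT0 : w T = 0 := by
          by_contra h
          exact hTS (hdisj T ((hmemB T).2 ⟨lt_of_le_of_ne (hw T) (Ne.symm h),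
            Finset.ne_empty_of_mem hiT⟩) S hS i hiT hi)
        simp [hT0]
      · simp [charVec, hiT]
    · simp
  refine ⟨B, fun S hS T hT hST => Finset.disjoint_left.2 fun i hiS hiT =>
    hST (hdisj S hS T hT i hiS hiT), fun h => ((hmemB ∅).1 h).2 rfl, ?_, ?_⟩
  · have h1 : ∑ S ∈ B, w S ≤ ∑ S, w S :=
      Finset.sum_le_sum_of_subset_of_nonneg (Finset.subset_univ B) fun S _ _ => hw S
    rw [Finset.sum_congr rfl hwr, hsum, Finset.sum_const, nsmul_eq_mul] at h1
    exact_mod_cast h1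
  · funext c
    have h1 : ∑ S, w S * (charVec ⊤ S c : ℝ) = ∑ S ∈ B, w S * (charVec ⊤ S c : ℝ) := by
      refine (Finset.sum_subset (Finset.subset_univ B) fun S _ hS => ?_).symm
      by_cases hS0 : S = ∅
      · simp [hS0, charVec_empty]
      · have : w S = 0 := by
          by_contra h
          exact hS ((hmemB S).2 ⟨lt_of_le_of_ne (hw S) (Ne.symm h), hS0⟩)
        simp [this]
    have h2 := hx c
    rw [h1, Finset.sum_congr rfl fun S hS => by rw [hwr S hS], ← Finset.mul_sum] at h2
    exact_mod_cast h2

theorem charVec_mem_graphPolytope (S : Finset (Fin n)) :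
    (fun c => (charVec G S c : ℝ)) ∈ graphPolytope G :=
  subset_convexHull ℝ _ ⟨S, rfl⟩

/-- Multiples of a characteristic vector up to the dilation factor lie in the dilated polytope. -/
theorem mul_charVec_mem_smul_graphPolytope {m r : ℕ} (hmr : r ≤ m) (S : Finset (Fin n)) :
    (fun c => (r : ℝ) * charVec G S c) ∈ (m : ℝ) • graphPolytope G := by
  -- By convexity `mP = rP + (m - r)P`; the second summand contributes `a_∅ = 0`.
  have h := (convex_convexHull ℝ
    (Set.range fun (S : Finset (Fin n)) (c : LiftCoord G) => (charVec G S c : ℝ))).add_smul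
    (Nat.cast_nonneg (α := ℝ) r) (Nat.cast_nonneg (α := ℝ) (m - r))
  rw [← Nat.cast_add, Nat.add_sub_cancel' hmr] at h
  rw [graphPolytope, h]
  refine ⟨_, Set.smul_mem_smul_set (charVec_mem_graphPolytope S), _,
    Set.smul_mem_smul_set (charVec_mem_graphPolytope ∅), ?_⟩
  funext c
  simp [charVec_empty]

end Graphical

theorem mainTheorem2 (n m r : ℕ) (hmr : r ≤ m) (aStar : Fin n → ℕ)
    (haStar : ∀ i, aStar i = 0 ∨ aStar i = r) :
    (∃ a ∈ liftedBundles (⊤ : SimpleGraph (Fin n)) m aStar, ∀ c, a c = 0 ∨ a c = (r : ℤ)) ∧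
    (∀ a ∈ liftedBundles (⊤ : SimpleGraph (Fin n)) m aStar,
      (r = 1 ∨ ∀ c, a c = 0 ∨ a c = (r : ℤ)) →
      ∀ v : Fin m → Finset (Fin n) → ℝ, (∀ b, IsGraphical (⊤ : SimpleGraph (Fin n)) (v b)) →
        ∃ p : LiftCoord (⊤ : SimpleGraph (Fin n)) → ℝ,
          HasCompetitiveEquilibriumAt (⊤ : SimpleGraph (Fin n)) v a p) := by
  classical
  refine ⟨?_, fun a ha hr v _ => ?_⟩
  · let S : Finset (Fin n) := Finset.univ.filter fun i => aStar i = r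
    refine ⟨fun c => r * charVec ⊤ S c, ⟨fun i => ?_, ?_⟩, fun c => ?_⟩
    · by_cases hi : aStar i = r
      · simp [charVec, S, hi]
      · have h0 : aStar i = 0 := (haStar i).resolve_right hi
        have hr0 : i ∉ S := by simpa [S] using hi
        simp [charVec, h0, hr0]
    · simpa using mul_charVec_mem_smul_graphPolytope (G := ⊤) hmr S
    · rcases c with i | e <;> simp only [charVec] <;> split_ifs <;> simp
  · have har : ∀ c, a c = 0 ∨ a c = (r : ℤ) := by
      rcases hr with rfl | hr
      · exact fun c => by simpa using eq_zero_or_eq_one_of_mem_liftedBundles haStar ha c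
      · exact hr
    obtain ⟨B, hB, hne, hm, rfl⟩ := exists_disjoint_family ha.2 har
    exact exists_equilibrium_of_disjoint B hB hne hm v
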